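/- **Theorem.** Let $G$ be a finite simple connected graph with $m$ edges in which every vertex has degree at least $2$ and which is not a cycle (i.e. some vertex has degree at least $3$). Let $\{X_k\}_{k\ge 0}$ be the non-backtracking random walk on the vertices of $G$: $X_1$ is a uniformly random neighbour of $X_0$, and for $k\ge 1$, $X_{k+1}$ is chosen uniformly among the neighbours of $X_k$ other than $X_{k-1}$. Put $T_v=\min\{k\ge 0: X_k=v\}$ and $T_v^+=\min\{k\ge 1: X_k=v\}$. Index $n\times n$ matrices by the vertices, and let the $2m$ arcs be the ordered pairs $(i,j)$ of adjacent vertices. Define the following matrices. * $(M_v^{(nb)})_{ij}=m_{ij}=\mathbb E[T_j\mid X_0=i]$ for $i\neq j$, and $m_{ii}=0$; $(M_{ev}^{(nb)})_{(i,j),v}=\mathbb E[T_v\mid X_0=i,X_1=j]$; $R$ is the diagonal matrix of mean return times $\mathbb E[T_i^+\mid X_0=i]$. * $D$ is the diagonal matrix of degrees; $D_e$ is the diagonal arc matrix with entry $\deg(j)$ at $(i,j)$; $J$ is the all-ones matrix. * $P_{nb}((i,j),(k,\ell))=\frac1{\deg(j)-1}$ if $j=k$ and $\ell\ne i$, and $0$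 otherwise. * $S((i,j),x)=1$ if $j=x$, else $0$; $T(x,(i,j))=1$ if $i=x$, else $0$; $\tau$ is the permutation matrix of $(i,j)\mapsto(j,i)$. * $\pi_j=\deg(j)/2m$, $W_v=\mathbb 1\pi^{\top}$, $W_e=\frac1{2m}\mathbb 1\mathbb 1^{\top}$ (on arcs). * $Z_e^{(nb)}=(I-P_{nb}+W_e)^{-1}$ and $Z^{(nb)}=(z_{ij})=I+D^{-1}TZ_e^{(nb)}S-W_v$. * $Y_{(i,j),k}=0$ if $k\ne i$, and $Y_{(i,j),i}=1+\sum_{\ell}P_{nb}((i,j),(j,\ell))\,(M^{(nb)}_{ev})_{(j,\ell),i}$, the sum being over the neighbours $\ell$ of $j$. * $F=-(\tau-P_{nb})Y$ and $E=D^{-1}TZ_e^{(nb)}D_e^{-1}F$. Then $I-P_{nb}+W_e$ is invertible, all the expectations above are finite, and $$M_v^{(nb)}=J-Z^{(nb)}R+W_vM_v^{(nb)}-E .$$ In particular, for all vertices $i,j$, $$m_{ij}=\frac{z_{jj}-z_{ij}}{\pi_j}+E_{jj}-E_{ij}.$$ -/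

import Mathlib

open MeasureTheory ProbabilityTheory
open scoped ENNReal Matrix

namespace NBRW

noncomputable section

variable {V : Type*} [Fintype V] [DecidableEq V] (G : SimpleGraph V) [DecidableRel G.Adj]

/-! ### The non-backtracking random walk on the vertices -/

/-- The vertices to which a non-backtracking walker with history `x 0, …, x n` may move next:
all neighbours of `x n`, except the vertex `x (n - 1)` visited just before (if `n ≥ 1`). -/
def next : (n : ℕ) → (Finset.Iic n → V) → Finset V
  | 0, x => G.neighborFinset (x ⟨0, by simp⟩)
  | n + 1, x => (G.neighborFinset (x ⟨n + 1, by simp⟩)).erase (x ⟨n, by simp⟩)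

variable {G} in
theorem next_nonempty (hdeg : ∀ v, 2 ≤ G.degree v) :
    (n : ℕ) → (x : Finset.Iic n → V) → (next G n x).Nonempty
  | 0, x => by
    rw [next, ← Finset.card_pos, SimpleGraph.card_neighborFinset_eq_degree]
    have := hdeg (x ⟨0, by simp⟩)
    omega
  | n + 1, x => by
    rw [next, ← Finset.card_pos]
    have h := Finset.pred_card_le_card_erase
      (s := G.neighborFinset (x ⟨n + 1, by simp⟩)) (a := x ⟨n, by simp⟩)
    rw [SimpleGraph.card_neighborFinset_eq_degree] at h
    have := hdeg (x ⟨n + 1, by simp⟩)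
    omega

variable [MeasurableSpace V] [DiscreteMeasurableSpace V]

/-- The distribution of the next vertex given the history `x 0, …, x n`: uniform on `next G n x`. -/
def stepKernel (n : ℕ) : Kernel (Finset.Iic n → V) V :=
  Kernel.ofFunOfCountable fun x => uniformOn (next G n x : Set V)

variable {G} in
theorem isMarkovKernel_stepKernel (hdeg : ∀ v, 2 ≤ G.degree v) (n : ℕ) :
    IsMarkovKernel (stepKernel G n) :=
  ⟨fun x => isProbabilityMeasure_uniformOn (Finset.finite_toSet _)
    (Finset.coe_nonempty.2 (next_nonempty hdeg n x))⟩

variable {G}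

/-- The law, on the space `ℕ → V` of trajectories, of the non-backtracking random walk
started at the vertex `i` (that is, conditioned on `X₀ = i`). -/
def law (hdeg : ∀ v, 2 ≤ G.degree v) (i : V) : Measure (ℕ → V) :=
  haveI := isMarkovKernel_stepKernel hdeg
  Kernel.traj (X := fun _ => V) (stepKernel G) 0 (fun _ => i)

/-- The first time `t ≥ 0` at which a trajectory is at `v` (`∞` if there is none). -/
def hitTime (v : V) (ω : ℕ → V) : ℝ≥0∞ :=
  ENat.toENNReal (hittingAfter (fun t (ω : ℕ → V) => ω t) {v} 0 ω)

/-- The first time `t ≥ 1` at which a trajectory is at `v` (`∞` if there is none). -/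
def returnTime (v : V) (ω : ℕ → V) : ℝ≥0∞ :=
  ENat.toENNReal (hittingAfter (fun t (ω : ℕ → V) => ω t) {v} 1 ω)

/-- `𝔼[T_v | X₀ = i]`. -/
def meanHit (hdeg : ∀ v, 2 ≤ G.degree v) (i v : V) : ℝ≥0∞ :=
  ∫⁻ ω, hitTime v ω ∂(law hdeg i)

/-- `𝔼[T_v | X₀ = i, X₁ = j]` for an arc `a = (i, j)`. -/
def meanHitArc (hdeg : ∀ v, 2 ≤ G.degree v) (a : G.Dart) (v : V) : ℝ≥0∞ :=
  ∫⁻ ω, hitTime v ω ∂((law hdeg a.fst)[|{ω | ω 1 = a.snd}])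

/-- The mean return time `𝔼[T_i⁺ | X₀ = i]`. -/
def meanReturn (hdeg : ∀ v, 2 ≤ G.degree v) (i : V) : ℝ≥0∞ :=
  ∫⁻ ω, returnTime i ω ∂(law hdeg i)

/-- The vertex-to-vertex matrix of first hitting times (zero on the diagonal). -/
def Mv (hdeg : ∀ v, 2 ≤ G.degree v) : Matrix V V ℝ :=
  Matrix.of fun i j => if i = j then 0 else (meanHit hdeg i j).toReal

/-- The arc-to-vertex matrix of first hitting times. -/
def Mev (hdeg : ∀ v, 2 ≤ G.degree v) : Matrix G.Dart V ℝ :=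
  Matrix.of fun a v => (meanHitArc hdeg a v).toReal

/-- The diagonal matrix of mean return times. -/
def R (hdeg : ∀ v, 2 ≤ G.degree v) : Matrix V V ℝ :=
  Matrix.diagonal fun i => (meanReturn hdeg i).toReal

/-! ### The matrices of the graph. The arcs `(i, j)` are the terms of `G.Dart`. -/

variable (G)

/-- The diagonal matrix of vertex degrees. -/
def D : Matrix V V ℝ := Matrix.diagonal fun v => (G.degree v : ℝ)

/-- The diagonal matrix whose entry at the arc `(i, j)` is `deg j`. -/
def De : Matrix G.Dart G.Dart ℝ := Matrix.diagonal fun a => (G.degree a.snd : ℝ)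

/-- The transition matrix of the non-backtracking random walk on arcs. -/
def Pnb : Matrix G.Dart G.Dart ℝ :=
  Matrix.of fun a b => if a.snd = b.fst ∧ b.snd ≠ a.fst then 1 / ((G.degree a.snd : ℝ) - 1) else 0

/-- Arc-to-vertex incidence by the end point. -/
def S : Matrix G.Dart V ℝ := Matrix.of fun a x => if a.snd = x then 1 else 0

/-- Vertex-to-arc incidence by the starting point. -/
def T : Matrix V G.Dart ℝ := Matrix.of fun x a => if a.fst = x then 1 else 0

/-- The matrix of the arc reversal `(i, j) ↦ (j, i)`. -/
def τ : Matrix G.Dart G.Dart ℝ := Matrix.of fun a b => if b = a.symm then 1 else 0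

/-- The stationary distribution `deg j / 2m` on the vertices. -/
def π (j : V) : ℝ := (G.degree j : ℝ) / (2 * (G.edgeFinset.card : ℝ))

/-- The matrix `𝟙 πᵀ`. -/
def Wv : Matrix V V ℝ := Matrix.of fun _ j => π G j

/-- The matrix `𝟙 πₑᵀ`, where `πₑ` is the uniform distribution on the `2m` arcs. -/
def We : Matrix G.Dart G.Dart ℝ := Matrix.of fun _ _ => 1 / (2 * (G.edgeFinset.card : ℝ))

/-- The fundamental matrix of the non-backtracking walk on arcs. -/
def Ze : Matrix G.Dart G.Dart ℝ := (1 - Pnb G + We G)⁻¹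

/-- The vertex-space fundamental matrix of the non-backtracking walk. -/
def Z : Matrix V V ℝ := 1 + (D G)⁻¹ * T G * Ze G * S G - Wv G

variable {G}

/-- The matrix `Y`: the entry at `((i, j), k)` is zero unless `k = i`, and the entry at
`((i, j), i)` is `1 + ∑_ℓ p_{i,j,ℓ} (Mev)_{(j,ℓ),i}`. -/
def Y (hdeg : ∀ v, 2 ≤ G.degree v) : Matrix G.Dart V ℝ :=
  Matrix.of fun a k =>
    if k = a.fst then 1 + ∑ b : G.Dart, Pnb G a b * Mev hdeg b k else 0

/-- The matrix `F = -(τ - P_nb) Y`. -/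
def F (hdeg : ∀ v, 2 ≤ G.degree v) : Matrix G.Dart V ℝ := -((τ G - Pnb G) * Y hdeg)

/-- The error matrix `E = D⁻¹ T Zₑ Dₑ⁻¹ F`. -/
def E (hdeg : ∀ v, 2 ≤ G.degree v) : Matrix V V ℝ :=
  (D G)⁻¹ * T G * Ze G * (De G)⁻¹ * F hdeg

end

end NBRW

namespace NBRW

/-! ### The transition matrix on arcs: double stochasticity, irreducibility, maximum principle. -/

section Arcs

set_option linter.unusedSectionVars false

variable {V : Type*} [Fintype V] [DecidableEq V] {G : SimpleGraph V} [DecidableRel G.Adj]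

/-! On arcs the walk is a Markov chain. Reversing arcs exchanges rows and columns of `Pnb`, so `Pnb`
is doubly stochastic; a vertex of degree at least 3 lets the walk turn round, so the chain is
irreducible. Hence harmonic functions are constant (`eq_of_harmonic`), and `1 - Pnb + We` is
invertible.

Finiteness: the maximum principle gives a nonnegative solution of the first-step equations
(`exists_hitting_bound`). It bounds every truncated expectation, hence the expectation itself. The
first-step equations come from the Markov property `arcLaw_map_shift`, proved by comparing measures
on cylinders.

The formula: the first-step equations read `(1 - Pnb) * Mev = J' - Y` with `J'` all ones, where `Y`
corrects the rows of arcs that start at the target. Since `Ze * (1 - Pnb) = 1 - We`, multiplying by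
`Ze` and averaging over outgoing arcs with `L = D⁻¹ * T` gives `Mv - Wv * Mv = J - L * Ze * Y`.
Moreover `Ze * Y = Y - We * Y + Ze * Pnb * Y`, where `L * Y = R` and `L * We * Y = J = Wv * R` by
Kac's formula. The identity `Pnb * Y = De⁻¹ * F + S * R` then turns `L * Ze * Y` into `Z * R + E`.
The term `E` measures how far `Y` is from depending only on the vertex an arc leaves; if it did, `F`
would vanish. -/

theorem dart_fst_eq_and_ne_iff (a b : G.Dart) :
    (a.snd = b.fst ∧ b.snd ≠ a.fst) ↔ (b.fst = a.snd ∧ b ≠ a.symm) := by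
  constructor
  · rintro ⟨h, h'⟩
    exact ⟨h.symm, fun e => h' (by simp [e])⟩
  · rintro ⟨h, h'⟩
    refine ⟨h.symm, fun e => h' ?_⟩
    ext <;> simp [h, e]

theorem sum_fst_eq_const (v : V) (c : ℝ) :
    ∑ b : G.Dart, (if b.fst = v then c else 0) = G.degree v * c := by
  rw [← Finset.sum_filter, Finset.sum_const, nsmul_eq_mul]
  rw [← SimpleGraph.dart_fst_fiber_card_eq_degree]

theorem Pnb_apply (a b : G.Dart) :
    Pnb G a b = (if b.fst = a.snd then 1 / ((G.degree a.snd : ℝ) - 1) else 0)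
      - (if b = a.symm then 1 / ((G.degree a.snd : ℝ) - 1) else 0) := by
  simp only [Pnb, Matrix.of_apply, dart_fst_eq_and_ne_iff]
  by_cases h : b = a.symm
  · simp [h]
  · simp [h]

theorem sum_Pnb_mul (a : G.Dart) (f : G.Dart → ℝ) :
    ∑ b, Pnb G a b * f b =
      ((∑ b, if b.fst = a.snd then f b else 0) - f a.symm) / ((G.degree a.snd : ℝ) - 1) := by
  simp only [Pnb_apply, sub_mul, Finset.sum_sub_distrib, ite_mul, zero_mul, Finset.sum_ite_eq',
    Finset.mem_univ, if_true, sub_div, Finset.sum_div]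
  congr 1
  · refine Finset.sum_congr rfl fun b _ => ?_
    split_ifs <;> ring
  · ring

theorem one_le_degree_sub_one (hdeg : ∀ v, 2 ≤ G.degree v) (v : V) :
    (1 : ℝ) ≤ (G.degree v : ℝ) - 1 := by
  have : (2 : ℝ) ≤ G.degree v := by exact_mod_cast hdeg v
  linarith

theorem sum_Pnb_row (hdeg : ∀ v, 2 ≤ G.degree v) (a : G.Dart) : ∑ b, Pnb G a b = 1 := by
  have h := sum_Pnb_mul a (fun _ => 1)
  have h1 := one_le_degree_sub_one hdeg a.snd
  simp only [mul_one, sum_fst_eq_const] at h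
  rw [h, div_self]
  linarith

/-- Both probabilities depend only on the degree of the shared middle vertex. This is what makes
column sums equal row sums. -/
theorem Pnb_symm (a b : G.Dart) : Pnb G b.symm a.symm = Pnb G a b := by
  simp only [Pnb, Matrix.of_apply, SimpleGraph.Dart.symm_toProd, Prod.fst_swap, Prod.snd_swap]
  by_cases h : a.snd = b.fst
  · rw [h]
    simp only [true_and, ne_comm]
    rfl
  · rw [if_neg fun h' => h h'.1.symm, if_neg fun h' => h h'.1]

theorem sum_Pnb_col (hdeg : ∀ v, 2 ≤ G.degree v) (b : G.Dart) : ∑ a, Pnb G a b = 1 := by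
  rw [← sum_Pnb_row hdeg b.symm]
  refine Finset.sum_equiv SimpleGraph.Dart.symm_involutive.toPerm (by simp) fun a _ => ?_
  exact (Pnb_symm a b).symm

theorem Pnb_nonneg (hdeg : ∀ v, 2 ≤ G.degree v) (a b : G.Dart) : 0 ≤ Pnb G a b := by
  have h1 := one_le_degree_sub_one hdeg a.snd
  simp only [Pnb, Matrix.of_apply]
  split_ifs
  · exact div_nonneg zero_le_one (by linarith)
  · exact le_rfl

theorem Pnb_pos (hdeg : ∀ v, 2 ≤ G.degree v) {a b : G.Dart} (h : a.snd = b.fst)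
    (h' : b.snd ≠ a.fst) : 0 < Pnb G a b := by
  have h1 := one_le_degree_sub_one hdeg a.snd
  simp only [Pnb, Matrix.of_apply]
  rw [if_pos ⟨h, h'⟩]
  exact div_pos zero_lt_one (by linarith)

/-- A function which is constant along the steps of the non-backtracking walk is constant. -/
theorem eq_of_forall_step (hconn : G.Connected) (hcycle : ∃ v, 3 ≤ G.degree v) (x : G.Dart → ℝ)
    (hx : ∀ a b : G.Dart, a.snd = b.fst → b.snd ≠ a.fst → x a = x b) (a b : G.Dart) :
    x a = x b := by
  have step : ∀ {u v w : V} (h : G.Adj u v) (h' : G.Adj v w), w ≠ u →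
      x ⟨(u, v), h⟩ = x ⟨(v, w), h'⟩ := fun h h' hn => hx _ _ rfl hn
  have other : ∀ v (s : Finset V), s.card < G.degree v → ∃ w, G.Adj v w ∧ w ∉ s := by
    intro v s hs
    rw [← SimpleGraph.card_neighborFinset_eq_degree] at hs
    obtain ⟨w, hw, hw'⟩ := Finset.exists_mem_notMem_of_card_lt_card hs
    exact ⟨w, by simpa using hw, hw'⟩
  -- a vertex at which some edge has the same value in both directions is uniform
  have spread : ∀ {u v : V} (h : G.Adj u v), x ⟨(u, v), h⟩ = x ⟨(v, u), h.symm⟩ →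
      ∀ w (h' : G.Adj v w), x ⟨(v, w), h'⟩ = x ⟨(u, v), h⟩ ∧ x ⟨(w, v), h'.symm⟩ = x ⟨(u, v), h⟩ := by
    intro u v h e w h'
    by_cases hw : w = u
    · subst hw
      exact ⟨e.symm, rfl⟩
    · exact ⟨(step h h' hw).symm, by rw [e, step h'.symm h.symm (Ne.symm hw)]⟩
  have big : ∀ {u v : V} (h : G.Adj u v), 3 ≤ G.degree v →
      x ⟨(u, v), h⟩ = x ⟨(v, u), h.symm⟩ := by
    intro u v h hv
    -- With `u`, `p`, `q` distinct neighbours of `v`, the steps `uv → vp`, `qv → vp`, `qv → vu` link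
    -- `uv` to `vu`.
    obtain ⟨p, hp, hp'⟩ := other v {u} (by simp; omega)
    obtain ⟨q, hq, hq'⟩ := other v {u, p} (lt_of_le_of_lt Finset.card_le_two (by omega))
    simp only [Finset.mem_insert, Finset.mem_singleton, not_or] at hp' hq'
    rw [step h hp hp', ← step hq.symm hp (Ne.symm hq'.2), step hq.symm h.symm (Ne.symm hq'.1)]
  obtain ⟨r, hr⟩ := hcycle
  obtain ⟨s, hs, -⟩ := other r ∅ (by simp; omega)
  have good : ∀ v, ∀ w (h : G.Adj v w), x ⟨(v, w), h⟩ = x ⟨(r, s), hs⟩ ∧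
      x ⟨(w, v), h.symm⟩ = x ⟨(r, s), hs⟩ := by
    intro v
    have key : ∀ {u v : V}, G.Walk u v → (∀ w (h : G.Adj u w), x ⟨(u, w), h⟩ = x ⟨(r, s), hs⟩ ∧
      x ⟨(w, u), h.symm⟩ = x ⟨(r, s), hs⟩) → (∀ w (h : G.Adj v w), x ⟨(v, w), h⟩ = x ⟨(r, s), hs⟩ ∧
      x ⟨(w, v), h.symm⟩ = x ⟨(r, s), hs⟩) := by
      intro u v p
      induction p with
      | nil => exact id
      | cons h p ih =>
        intro H
        refine ih fun w h' => ?_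
        have := spread h ((H _ h).1.trans (H _ h).2.symm) w h'
        rwa [(H _ h).1] at this
    refine key (hconn.preconnected r v).some fun w h => ?_
    have := spread hs.symm (big hs.symm hr) w h
    rwa [big hs.symm hr] at this
  exact ((good a.fst a.snd a.adj).1).trans ((good b.fst b.snd b.adj).1).symm

/-- Energy argument: by harmonicity and double stochasticity, the sum of `Pnb a b * (x a - x b) ^ 2`
telescopes to zero, so `x` is unchanged along every possible step. -/
theorem eq_of_harmonic (hconn : G.Connected) (hdeg : ∀ v, 2 ≤ G.degree v)
    (hcycle : ∃ v, 3 ≤ G.degree v) (x : G.Dart → ℝ)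
    (hx : ∀ a, ∑ b, Pnb G a b * x b = x a) (a b : G.Dart) : x a = x b := by
  have h0 : ∑ a, ∑ b, Pnb G a b * (x a - x b) ^ 2 = 0 := by
    have e : ∀ a, ∑ b, Pnb G a b * (x a - x b) ^ 2 =
        ∑ b, Pnb G a b * x b ^ 2 - x a ^ 2 := by
      intro a
      have : ∀ b, Pnb G a b * (x a - x b) ^ 2 =
          x a ^ 2 * Pnb G a b - 2 * x a * (Pnb G a b * x b) + Pnb G a b * x b ^ 2 := by
        intro b; ring
      simp only [this, Finset.sum_add_distrib, Finset.sum_sub_distrib, ← Finset.mul_sum,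
        sum_Pnb_row hdeg, hx]
      ring
    simp only [e, Finset.sum_sub_distrib]
    rw [Finset.sum_comm]
    simp only [← Finset.sum_mul, sum_Pnb_col hdeg, one_mul, sub_self]
  have hn : ∀ a b, 0 ≤ Pnb G a b * (x a - x b) ^ 2 := fun a b =>
    mul_nonneg (Pnb_nonneg hdeg a b) (sq_nonneg _)
  refine eq_of_forall_step hconn hcycle x (fun a b h h' => ?_) a b
  have h1 := (Finset.sum_eq_zero_iff_of_nonneg fun a _ => Finset.sum_nonneg fun b _ => hn a b).1 h0
    a (Finset.mem_univ _)
  have h2 := (Finset.sum_eq_zero_iff_of_nonneg fun b _ => hn a b).1 h1 b (Finset.mem_univ _)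
  have h3 := (mul_eq_zero.1 h2).resolve_left (Pnb_pos hdeg h h').ne'
  exact sub_eq_zero.1 (pow_eq_zero_iff two_ne_zero |>.1 h3)

/-- A nonempty set of arcs closed under the steps of the non-backtracking walk is everything. -/
theorem forall_mem_of_closed (hconn : G.Connected) (hdeg : ∀ v, 2 ≤ G.degree v)
    (hcycle : ∃ v, 3 ≤ G.degree v) (s : Set G.Dart) {a₀ : G.Dart} (h₀ : a₀ ∈ s)
    (hs : ∀ a ∈ s, ∀ b : G.Dart, 0 < Pnb G a b → b ∈ s) (a : G.Dart) : a ∈ s := by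
  classical
  set f : G.Dart → ℝ := fun a => if a ∈ s then 1 else 0 with hf
  have hf0 : ∀ a, 0 ≤ f a := fun a => by simp only [hf]; split_ifs <;> norm_num
  -- The indicator of a closed set is subharmonic. Both sides have the same total because columns
  -- sum to 1, so it is harmonic and therefore constant.
  have hle : ∀ a, f a ≤ ∑ b, Pnb G a b * f b := by
    intro a
    by_cases ha : a ∈ s
    · have : ∀ b, Pnb G a b * f b = Pnb G a b := by
        intro b
        rcases (Pnb_nonneg hdeg a b).eq_or_lt with h | h
        · simp [← h]
        · simp [hf, hs a ha b h]
      simp only [this, sum_Pnb_row hdeg]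
      simp [hf, ha]
    · have : f a = 0 := by simp [hf, ha]
      rw [this]
      exact Finset.sum_nonneg fun b _ => mul_nonneg (Pnb_nonneg hdeg a b) (hf0 b)
  have hsum : ∑ a, f a = ∑ a, ∑ b, Pnb G a b * f b := by
    rw [Finset.sum_comm]
    simp only [← Finset.sum_mul, sum_Pnb_col hdeg, one_mul]
  have heq := (Finset.sum_eq_sum_iff_of_le fun a _ => hle a).1 hsum
  have := eq_of_harmonic hconn hdeg hcycle f (fun a => (heq a (Finset.mem_univ a)).symm) a a₀
  by_contra ha
  simp [hf, ha, h₀] at this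

theorem card_dart_eq : (Fintype.card G.Dart : ℝ) = 2 * (G.edgeFinset.card : ℝ) := by
  rw [SimpleGraph.dart_card_eq_twice_card_edges]
  push_cast
  rfl

theorem nonempty_dart (hcycle : ∃ v, 3 ≤ G.degree v) : Nonempty G.Dart := by
  obtain ⟨v, hv⟩ := hcycle
  obtain ⟨w, hw⟩ := (G.degree_pos_iff_exists_adj v).1 (by omega)
  exact ⟨⟨(v, w), hw⟩⟩

theorem two_mul_card_edgeFinset_pos (hcycle : ∃ v, 3 ≤ G.degree v) :
    0 < 2 * (G.edgeFinset.card : ℝ) := by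
  have := nonempty_dart hcycle
  rw [← card_dart_eq]
  exact_mod_cast Fintype.card_pos

/-! ### Invertibility, and solvability of the first-step equations. -/

theorem isUnit_of_forall_mulVec_eq_zero {ι : Type*} [Fintype ι] [DecidableEq ι]
    {A : Matrix ι ι ℝ} (h : ∀ x, A *ᵥ x = 0 → x = 0) : IsUnit A := by
  rw [Matrix.isUnit_iff_isUnit_det, isUnit_iff_ne_zero]
  intro h0
  obtain ⟨x, hx, hx'⟩ := Matrix.exists_mulVec_eq_zero_iff.2 h0
  exact hx (h x hx')

/-- Summing the kernel equation over all arcs shows that a kernel vector has sum zero. It is then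
harmonic, hence constant, hence zero. -/
theorem isUnit_one_sub_Pnb_add_We (hconn : G.Connected) (hdeg : ∀ v, 2 ≤ G.degree v)
    (hcycle : ∃ v, 3 ≤ G.degree v) : IsUnit (1 - Pnb G + We G) := by
  have hm := two_mul_card_edgeFinset_pos hcycle
  refine isUnit_of_forall_mulVec_eq_zero fun x hx => ?_
  have hx' : ∀ a, x a - ∑ b, Pnb G a b * x b + (∑ b, x b) / (2 * (G.edgeFinset.card : ℝ)) = 0 := by
    intro a
    have := congrFun hx a
    rw [Matrix.add_mulVec, Matrix.sub_mulVec, Matrix.one_mulVec] at this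
    simp only [Matrix.mulVec, dotProduct, Pi.add_apply, Pi.sub_apply, We, Matrix.of_apply,
      Pi.zero_apply, ← Finset.mul_sum] at this
    rw [← this]
    ring
  have hsum : ∑ b, x b = 0 := by
    have h1 : ∑ a, (x a - ∑ b, Pnb G a b * x b
        + (∑ b, x b) / (2 * (G.edgeFinset.card : ℝ))) = 0 := Finset.sum_eq_zero fun a _ => hx' a
    rw [Finset.sum_add_distrib, Finset.sum_sub_distrib, Finset.sum_comm] at h1
    simp only [← Finset.sum_mul, sum_Pnb_col hdeg, one_mul, sub_self, zero_add, Finset.sum_const,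
      Finset.card_univ, nsmul_eq_mul, card_dart_eq] at h1
    rwa [mul_div_cancel₀ _ hm.ne'] at h1
  simp only [hsum, zero_div, add_zero, sub_eq_zero] at hx'
  have hc := eq_of_harmonic hconn hdeg hcycle x fun a => (hx' a).symm
  funext a
  have : ∑ b, x b = (2 * (G.edgeFinset.card : ℝ)) * x a := by
    simp only [fun b => hc b a, Finset.sum_const, Finset.card_univ, nsmul_eq_mul, card_dart_eq]
  rw [hsum] at this
  exact (mul_eq_zero.1 this.symm).resolve_left hm.ne'

/-- The maximum principle for the non-backtracking walk on arcs, stopped on leaving `v`. -/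
theorem nonpos_of_subharmonic (hconn : G.Connected) (hdeg : ∀ v, 2 ≤ G.degree v)
    (hcycle : ∃ v, 3 ≤ G.degree v) (v : V) (x : G.Dart → ℝ)
    (h0 : ∀ a, a.fst = v → x a ≤ 0) (h1 : ∀ a, a.fst ≠ v → x a ≤ ∑ b, Pnb G a b * x b)
    (a : G.Dart) : x a ≤ 0 := by
  have := nonempty_dart hcycle
  obtain ⟨c, hc⟩ := Finite.exists_max x
  refine (hc a).trans (le_of_not_gt fun hpos => ?_)
  -- A positive maximum would propagate along steps to every arc, including one leaving `v`, where
  -- `x ≤ 0`.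
  have hall := forall_mem_of_closed hconn hdeg hcycle {b | x b = x c} (a₀ := c) rfl
  obtain ⟨w, hw⟩ := (G.degree_pos_iff_exists_adj v).1 (by have := hdeg v; omega)
  have hv : x ⟨(v, w), hw⟩ = x c := by
    refine hall (fun d hd b hb => ?_) _
    have hd' : x d = x c := hd
    have hdv : d.fst ≠ v := fun h => (h0 d h).not_gt (hd' ▸ hpos)
    have hle : ∀ b ∈ Finset.univ, Pnb G d b * x b ≤ Pnb G d b * x c := fun b _ =>
      mul_le_mul_of_nonneg_left (hc b) (Pnb_nonneg hdeg d b)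
    have hs : ∑ b, Pnb G d b * x c = x c := by
      rw [← Finset.sum_mul, sum_Pnb_row hdeg, one_mul]
    have heq := (Finset.sum_eq_sum_iff_of_le hle).1
      (le_antisymm (Finset.sum_le_sum hle) (by rw [hs, ← hd']; exact h1 d hdv)) b
      (Finset.mem_univ _)
    exact mul_left_cancel₀ hb.ne' heq
  exact (h0 _ rfl).not_gt (hv ▸ hpos)

/-- A finite nonnegative function satisfying the first step equations of the hitting time of `v`. -/
theorem exists_hitting_bound (hconn : G.Connected) (hdeg : ∀ v, 2 ≤ G.degree v)
    (hcycle : ∃ v, 3 ≤ G.degree v) (v : V) :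
    ∃ h : G.Dart → ℝ, (∀ a, 0 ≤ h a) ∧ ∀ a, a.fst ≠ v → h a = 1 + ∑ b, Pnb G a b * h b := by
  let Q : Matrix G.Dart G.Dart ℝ := Matrix.of fun a b => if a.fst = v then 0 else Pnb G a b
  have hQ : ∀ x a, ((1 - Q) *ᵥ x) a = x a - if a.fst = v then 0 else ∑ b, Pnb G a b * x b := by
    intro x a
    rw [Matrix.sub_mulVec, Matrix.one_mulVec, Pi.sub_apply]
    simp only [Matrix.mulVec, dotProduct, Q, Matrix.of_apply]
    split_ifs <;> simp
  have hU : IsUnit (1 - Q) := by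
    refine isUnit_of_forall_mulVec_eq_zero fun x hx => ?_
    have hx' : ∀ a, x a = if a.fst = v then 0 else ∑ b, Pnb G a b * x b := fun a =>
      sub_eq_zero.1 ((hQ x a).symm.trans (congrFun hx a))
    funext a
    refine le_antisymm (nonpos_of_subharmonic hconn hdeg hcycle v x ?_ ?_ a)
      (neg_nonpos.1 (nonpos_of_subharmonic hconn hdeg hcycle v (-x) ?_ ?_ a))
    · intro a ha; rw [hx', if_pos ha]
    · intro a ha; rw [hx', if_neg ha]
    · intro a ha; rw [Pi.neg_apply, hx', if_pos ha, neg_zero]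
    · intro a ha
      rw [Pi.neg_apply, hx', if_neg ha]
      simp
  -- This `h` equals 1, not 0, on arcs leaving `v`; that is harmless since only an upper bound for
  -- the hitting time is needed.
  obtain ⟨h, hh⟩ := Matrix.mulVec_surjective_iff_isUnit.2 hU (fun _ => 1)
  have hh' : ∀ a, h a - (if a.fst = v then 0 else ∑ b, Pnb G a b * h b) = 1 := fun a =>
    (hQ h a).symm.trans (congrFun hh a)
  refine ⟨h, fun a => neg_nonpos.1 (nonpos_of_subharmonic hconn hdeg hcycle v (-h) ?_ ?_ a), ?_⟩
  · intro a ha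
    have := hh' a
    rw [if_pos ha] at this
    simp only [Pi.neg_apply]
    linarith
  · intro a ha
    have := hh' a
    rw [if_neg ha] at this
    simp only [Pi.neg_apply, mul_neg, Finset.sum_neg_distrib]
    linarith
  · intro a ha
    have := hh' a
    rw [if_neg ha] at this
    linarith

end Arcs

end NBRW

namespace NBRW

noncomputable section

set_option linter.unusedSectionVars false

/-! ### Cylinders and hitting times of trajectories -/

section Trajectories

variable {V : Type*}

/-- The trajectories which agree with `x` up to time `n`. -/
def cyl (n : ℕ) (x : ℕ → V) : Set (ℕ → V) := {ω | ∀ k ≤ n, ω k = x k}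

theorem cyl_eq_preimage (n : ℕ) (x : ℕ → V) :
    cyl n x = Preorder.frestrictLe (π := fun _ => V) n ⁻¹' {Preorder.frestrictLe n x} := by
  ext ω
  simp only [cyl, Set.mem_ofPred_eq, Set.mem_preimage, Set.mem_singleton_iff]
  constructor
  · intro h
    ext k
    exact h k (Finset.mem_Iic.1 k.2)
  · intro h k hk
    exact congrFun h ⟨k, Finset.mem_Iic.2 hk⟩

/-- The trajectory with its first vertex removed. -/
def shift (ω : ℕ → V) : ℕ → V := fun k => ω (k + 1)

/-- The trajectory with the vertex `y` put in front. -/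
def cons (y : V) (x : ℕ → V) : ℕ → V
  | 0 => y
  | k + 1 => x k

theorem mem_cyl_cons {n : ℕ} {y : V} {x ω : ℕ → V} :
    ω ∈ cyl (n + 1) (cons y x) ↔ ω 0 = y ∧ shift ω ∈ cyl n x := by
  constructor
  · exact fun h => ⟨h 0 (Nat.zero_le _), fun k hk => h (k + 1) (by omega)⟩
  · rintro ⟨h, h'⟩ (_ | k) hk
    · exact h
    · exact h' k (by omega)

theorem hittingAfter_eq_add {v : V} {n m : ℕ} {ω : ℕ → V} (h : ω (n + m) = v)
    (h' : ∀ k < m, ω (n + k) ≠ v) :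
    ENat.toENNReal (hittingAfter (fun t (ω : ℕ → V) => ω t) {v} n ω) = (n + m : ℕ) := by
  have e : sInf {i : ℕ | n ≤ i ∧ ω i ∈ ({v} : Set V)} = n + m := by
    refine (IsLeast.csInf_eq ⟨⟨Nat.le_add_right n m, h⟩, ?_⟩)
    rintro i ⟨hi, hi'⟩
    by_contra hlt
    obtain ⟨k, rfl⟩ := Nat.exists_eq_add_of_le hi
    exact h' k (by omega) hi'
  rw [hittingAfter, if_pos ⟨n + m, Nat.le_add_right n m, h⟩, e]
  exact ENat.toENNReal_coe _

theorem hittingAfter_eq_top {v : V} {n : ℕ} {ω : ℕ → V} (h : ∀ k, ω (n + k) ≠ v) :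
    ENat.toENNReal (hittingAfter (fun t (ω : ℕ → V) => ω t) {v} n ω) = ∞ := by
  rw [hittingAfter_eq_top_iff.2]
  · rfl
  · rintro j hj hj'
    obtain ⟨k, rfl⟩ := Nat.exists_eq_add_of_le hj
    exact h k hj'

theorem returnTime_eq (v : V) (ω : ℕ → V) : returnTime v ω = 1 + hitTime v (shift ω) := by
  classical
  by_cases h : ∃ k, ω (1 + k) = v
  · have hs : ∀ k, shift ω (0 + k) = ω (1 + k) := fun k => by simp [shift, add_comm]
    rw [returnTime, hitTime, hittingAfter_eq_add (Nat.find_spec h) fun k hk => Nat.find_min h hk,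
      hittingAfter_eq_add (n := 0) (m := Nat.find h) (by rw [hs]; exact Nat.find_spec h)
        (fun k hk => by rw [hs]; exact Nat.find_min h hk)]
    push_cast
    simp
  · push Not at h
    rw [returnTime, hitTime, hittingAfter_eq_top h, hittingAfter_eq_top, add_top]
    intro k
    simpa [shift, add_comm] using h k

theorem hitTime_of_eq {v : V} {ω : ℕ → V} (h : ω 0 = v) : hitTime v ω = 0 := by
  rw [hitTime, hittingAfter_eq_add (m := 0) h (by simp)]
  simp

theorem hitTime_of_ne {v : V} {ω : ℕ → V} (h : ω 0 ≠ v) :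
    hitTime v ω = 1 + hitTime v (shift ω) := by
  rw [← returnTime_eq, hitTime, returnTime]
  classical
  by_cases h' : ∃ k, ω (1 + k) = v
  · rw [hittingAfter_eq_add (Nat.find_spec h') fun k hk => Nat.find_min h' hk,
      hittingAfter_eq_add (n := 0) (m := 1 + Nat.find h') (by simpa using Nat.find_spec h'),
      zero_add]
    rintro (_ | k) hk
    · exact h
    · rw [zero_add, add_comm]
      exact Nat.find_min h' (by omega)
  · push Not at h'
    rw [hittingAfter_eq_top h', hittingAfter_eq_top]
    rintro (_ | k)
    · exact h
    · rw [zero_add, add_comm]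
      exact h' k

/-- A countable infimum of simple functions of single coordinates, which gives measurability. -/
theorem hitTime_eq_iInf [DecidableEq V] (v : V) (ω : ℕ → V) :
    hitTime v ω = ⨅ k : ℕ, if ω k = v then (k : ℝ≥0∞) else ∞ := by
  by_cases h : ∃ k, ω (0 + k) = v
  · rw [hitTime, hittingAfter_eq_add (Nat.find_spec h) fun k hk => Nat.find_min h hk]
    refine le_antisymm (le_iInf fun k => ?_) (iInf_le_of_le (0 + Nat.find h) ?_)
    · split_ifs with hk
      · rw [zero_add]
        exact_mod_cast Nat.find_min' h (by rwa [zero_add])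
      · exact le_top
    · rw [if_pos (Nat.find_spec h)]
  · push Not at h
    rw [hitTime, hittingAfter_eq_top h]
    simp only [zero_add] at h
    simp [h]

variable [MeasurableSpace V] [DiscreteMeasurableSpace V]

theorem measurable_hitTime (v : V) : Measurable (hitTime v : (ℕ → V) → ℝ≥0∞) := by
  classical
  rw [funext (hitTime_eq_iInf v)]
  refine Measurable.iInf fun k => Measurable.ite ?_ measurable_const measurable_const
  exact (measurable_pi_apply (X := fun _ : ℕ => V) k) (MeasurableSet.of_discrete (s := {v}))

theorem measurable_shift : Measurable (shift : (ℕ → V) → ℕ → V) :=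
  measurable_pi_lambda _ fun k => measurable_pi_apply (k + 1)

variable [Fintype V]

theorem measurableSet_cyl (n : ℕ) (x : ℕ → V) : MeasurableSet (cyl n x) := by
  rw [cyl_eq_preimage]
  exact Preorder.measurable_frestrictLe n (measurableSet_singleton _)

/-- Uniqueness of projective limits: every finite set of times lies in some initial segment `Iic (n
+ 1)`. Index 0 is skipped because the non-backtracking rule starts from two vertices. -/
theorem ext_of_cyl {μ ν : Measure (ℕ → V)} [IsFiniteMeasure μ]
    (h : ∀ n x, μ (cyl (n + 1) x) = ν (cyl (n + 1) x)) : μ = ν := by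
  have hm : ∀ n, μ.map (Preorder.frestrictLe (π := fun _ => V) (n + 1)) =
      ν.map (Preorder.frestrictLe (n + 1)) := by
    intro n
    refine Measure.ext_of_singleton fun y => ?_
    rw [Measure.map_apply (Preorder.measurable_frestrictLe _) (measurableSet_singleton _),
      Measure.map_apply (Preorder.measurable_frestrictLe _) (measurableSet_singleton _)]
    -- Beyond time `n + 1` the value is irrelevant; `y 0` merely supplies an element of `V`.
    have := h n (fun k => if hk : k ≤ n + 1 then y ⟨k, Finset.mem_Iic.2 hk⟩ else y ⟨0, by simp⟩)
    rw [cyl_eq_preimage] at this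
    convert this using 4 <;>
    · ext k
      have := Finset.mem_Iic.1 k.2
      simp [this]
  refine IsProjectiveLimit.unique (P := fun I => μ.map I.restrict) (fun I => rfl) fun I => ?_
  have hI : I ⊆ Finset.Iic (I.sup id + 1) := fun k hk =>
    Finset.mem_Iic.2 ((Finset.le_sup (f := id) hk).trans (Nat.le_succ _))
  have e : (I.restrict : (ℕ → V) → _) =
      Finset.restrict₂ hI ∘ Preorder.frestrictLe (I.sup id + 1) := rfl
  change _ = μ.map I.restrict
  rw [e, ← Measure.map_map (Finset.measurable_restrict₂ _) (Preorder.measurable_frestrictLe _),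
    ← Measure.map_map (Finset.measurable_restrict₂ _) (Preorder.measurable_frestrictLe _), hm]

end Trajectories

end

end NBRW

namespace NBRW

noncomputable section

set_option linter.unusedSectionVars false

/-! ### The law of the walk -/

section Law

variable {V : Type*} [Fintype V] [DecidableEq V] {G : SimpleGraph V} [DecidableRel G.Adj]

variable (G) in
/-- The probability that a walker which came from `u` to `v` moves on to `y`. -/
def stepProb (u v y : V) : ℝ≥0∞ :=
  if y ∈ (G.neighborFinset v).erase u then (((G.neighborFinset v).erase u).card : ℝ≥0∞)⁻¹ else 0

theorem ofReal_Pnb (hdeg : ∀ v, 2 ≤ G.degree v) (a b : G.Dart) :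
    ENNReal.ofReal (Pnb G a b) = if a.snd = b.fst then stepProb G a.fst a.snd b.snd else 0 := by
  have hc : ((G.neighborFinset a.snd).erase a.fst).card = G.degree a.snd - 1 := by
    rw [Finset.card_erase_of_mem (by simpa using a.adj.symm),
      SimpleGraph.card_neighborFinset_eq_degree]
  have h1 := one_le_degree_sub_one hdeg a.snd
  rw [Pnb, Matrix.of_apply, stepProb]
  by_cases h : a.snd = b.fst
  · have hadj : G.Adj a.snd b.snd := h ▸ b.adj
    by_cases h' : b.snd = a.fst
    · simp [h']
    · have hd : ((G.degree a.snd - 1 : ℕ) : ℝ) = (G.degree a.snd : ℝ) - 1 := by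
        have := hdeg a.snd
        push_cast [Nat.cast_sub (show 1 ≤ G.degree a.snd by omega)]
        rfl
      rw [if_pos ⟨h, h'⟩, if_pos h, if_pos (by simpa [h'] using hadj), hc, one_div,
        ENNReal.ofReal_inv_of_pos (by linarith), ← hd, ENNReal.ofReal_natCast]
  · simp [h]

variable [MeasurableSpace V] [DiscreteMeasurableSpace V]

/-- The property that, from time `1` on, trajectories move as the non-backtracking walk does. -/
def IsNonbacktracking (G : SimpleGraph V) [DecidableRel G.Adj] (μ : Measure (ℕ → V)) : Prop :=
  ∀ n x, μ (cyl (n + 2) x) = μ (cyl (n + 1) x) * stepProb G (x n) (x (n + 1)) (x (n + 2))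

namespace IsNonbacktracking

/-- The joint law of the first two vertices determines the rest by induction on cylinder length. -/
theorem ext {μ ν : Measure (ℕ → V)} [IsFiniteMeasure μ] (hμ : IsNonbacktracking G μ)
    (hν : IsNonbacktracking G ν) (h : ∀ x, μ (cyl 1 x) = ν (cyl 1 x)) : μ = ν := by
  refine ext_of_cyl fun n x => ?_
  induction n with
  | zero => exact h x
  | succ n ih => rw [hμ n x, hν n x, ih]

theorem sum_smul {ι : Type*} [Fintype ι] (c : ι → ℝ≥0∞) (μ : ι → Measure (ℕ → V))
    (h : ∀ i, IsNonbacktracking G (μ i)) : IsNonbacktracking G (∑ i, c i • μ i) := by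
  intro n x
  simp only [Measure.finsetSum_apply, Measure.smul_apply, smul_eq_mul, Finset.sum_mul]
  exact Finset.sum_congr rfl fun i _ => by rw [h i n x, mul_assoc]

end IsNonbacktracking

variable (hdeg : ∀ v, 2 ≤ G.degree v)

instance (i : V) : IsProbabilityMeasure (law hdeg i) := by
  have := isMarkovKernel_stepKernel hdeg
  unfold law
  infer_instance

/-- The Ionescu-Tulcea recursion, evaluated on a single history and a single next vertex. -/
theorem law_cyl_succ (i : V) (n : ℕ) (x : ℕ → V) :
    law hdeg i (cyl (n + 1) x) = law hdeg i (cyl n x) *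
      uniformOn (next G n (Preorder.frestrictLe n x) : Set V) {x (n + 1)} := by
  have := isMarkovKernel_stepKernel hdeg
  have h := Kernel.partialTraj_compProd_eq_map_traj (X := fun _ => V) (κ := stepKernel G)
    (Nat.zero_le n) (x₀ := fun _ => i)
  have h1 := congrArg (fun μ => μ ({Preorder.frestrictLe n x} ×ˢ {x (n + 1)})) h
  have hmeas : Measurable fun ω : ℕ → V =>
    (Preorder.frestrictLe (π := fun _ => V) n ω, ω (n + 1)) :=
    (Preorder.measurable_frestrictLe n).prodMk (measurable_pi_apply _)
  rw [Measure.compProd_apply_prod (measurableSet_singleton _) (measurableSet_singleton _),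
    Measure.map_apply hmeas ((measurableSet_singleton _).prod (measurableSet_singleton _)),
    Measure.restrict_singleton, lintegral_smul_measure, lintegral_dirac,
    ← Kernel.traj_map_frestrictLe_apply, Measure.map_apply (Preorder.measurable_frestrictLe n)
      (measurableSet_singleton _), ← cyl_eq_preimage] at h1
  have hset : cyl (n + 1) x = (fun ω : ℕ → V => (Preorder.frestrictLe (π := fun _ => V) n ω,
      ω (n + 1))) ⁻¹' ({Preorder.frestrictLe n x} ×ˢ {x (n + 1)}) := by
    have h2 : cyl (n + 1) x = cyl n x ∩ {ω | ω (n + 1) = x (n + 1)} := by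
      ext ω
      constructor
      · exact fun h => ⟨fun k hk => h k (by omega), h _ le_rfl⟩
      · rintro ⟨h, h'⟩ k hk
        rcases hk.lt_or_eq with hk | rfl
        · exact h k (by omega)
        · exact h'
    rw [h2, cyl_eq_preimage]
    rfl
  rw [hset]
  exact h1.symm

theorem uniformOn_singleton_apply (s : Finset V) (y : V) :
    uniformOn (s : Set V) {y} = if y ∈ s then (s.card : ℝ≥0∞)⁻¹ else 0 := by
  rw [← Finset.coe_singleton, uniformOn_apply_finset]
  split_ifs with h
  · rw [Finset.inter_singleton_of_mem h]
    simp
  · rw [Finset.inter_singleton_of_notMem h]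
    simp

theorem isNonbacktracking_law (i : V) : IsNonbacktracking G (law hdeg i) := by
  intro n x
  rw [law_cyl_succ, uniformOn_singleton_apply]
  rfl

theorem law_ae_zero (i : V) : ∀ᵐ ω ∂(law hdeg i), ω 0 = i := by
  have := isMarkovKernel_stepKernel hdeg
  have h := Kernel.traj_map_frestrictLe_apply (X := fun _ => V) (κ := stepKernel G) 0 0 (fun _ => i)
  rw [Kernel.partialTraj_self, Kernel.id_apply] at h
  have h2 : ∀ᵐ y ∂((law hdeg i).map (Preorder.frestrictLe (π := fun _ => V) 0)),
      y = fun _ => i := by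
    rw [law, h]
    rw [ae_dirac_eq]
    rfl
  have h3 := ae_of_ae_map (Preorder.measurable_frestrictLe (X := fun _ => V) 0).aemeasurable h2
  filter_upwards [h3] with ω hω
  exact congrFun hω ⟨0, by simp⟩

theorem law_cyl_one (i : V) (x : ℕ → V) :
    law hdeg i (cyl 1 x) =
      if x 0 = i ∧ G.Adj (x 0) (x 1) then (G.degree i : ℝ≥0∞)⁻¹ else 0 := by
  have h0 : law hdeg i (cyl 0 x) = if x 0 = i then 1 else 0 := by
    have e : (cyl 0 x : Set (ℕ → V)) =ᵐ[law hdeg i] {_ω | x 0 = i} := by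
      filter_upwards [law_ae_zero hdeg i] with ω hω
      refine propext ?_
      change (∀ k ≤ 0, ω k = x k) ↔ x 0 = i
      simp [hω, eq_comm]
    rw [measure_congr e]
    by_cases h : x 0 = i <;> simp [h]
  rw [law_cyl_succ, h0, uniformOn_singleton_apply]
  by_cases h : x 0 = i
  · change (if x 0 = i then 1 else 0) * (if x 1 ∈ G.neighborFinset (x 0) then
      ((G.neighborFinset (x 0)).card : ℝ≥0∞)⁻¹ else 0) = _
    subst h
    simp
  · simp [h]

variable {hdeg} in
theorem law_congr_zero {i : V} {s t : Set (ℕ → V)} (h : ∀ ω, ω 0 = i → (ω ∈ s ↔ ω ∈ t)) :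
    law hdeg i s = law hdeg i t := by
  refine measure_congr ?_
  filter_upwards [law_ae_zero hdeg i] with ω hω
  exact propext (h ω hω)

theorem law_snd (a : G.Dart) :
    law hdeg a.fst {ω | ω 1 = a.snd} = (G.degree a.fst : ℝ≥0∞)⁻¹ := by
  have h := law_cyl_one hdeg a.fst (cons a.fst fun _ => a.snd)
  rw [if_pos ⟨rfl, a.adj⟩] at h
  rw [← h]
  refine law_congr_zero fun ω hω => ?_
  rw [mem_cyl_cons]
  simp [cyl, shift, hω]

/-- The law of the walk conditioned on its first step. -/
def arcLaw (a : G.Dart) : Measure (ℕ → V) := (law hdeg a.fst)[|{ω | ω 1 = a.snd}]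

theorem measurableSet_snd (y : V) : MeasurableSet {ω : ℕ → V | ω 1 = y} :=
  (measurable_pi_apply (X := fun _ : ℕ => V) 1) (MeasurableSet.of_discrete (s := {y}))

instance (a : G.Dart) : IsProbabilityMeasure (arcLaw hdeg a) := by
  refine cond_isProbabilityMeasure ?_
  rw [law_snd]
  simp

theorem arcLaw_ae_zero (a : G.Dart) : ∀ᵐ ω ∂(arcLaw hdeg a), ω 0 = a.fst :=
  cond_absolutelyContinuous.ae_le (law_ae_zero hdeg a.fst)

/-- The conditioning event has probability `1 / deg`, and a cylinder fixing time 1 is either inside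
it or disjoint from it. -/
theorem arcLaw_cyl (a : G.Dart) (n : ℕ) (x : ℕ → V) :
    arcLaw hdeg a (cyl (n + 1) x) =
      if x 1 = a.snd then G.degree a.fst * law hdeg a.fst (cyl (n + 1) x) else 0 := by
  rw [arcLaw, cond_apply (measurableSet_snd _), law_snd, inv_inv]
  split_ifs with h
  · congr 2
    refine Set.inter_eq_right.2 fun ω hω => ?_
    exact (hω 1 (by omega)).trans h
  · have : {ω : ℕ → V | ω 1 = a.snd} ∩ cyl (n + 1) x = ∅ := by
      refine Set.eq_empty_of_forall_notMem fun ω hω => h ?_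
      exact (hω.2 1 (by omega)).symm.trans hω.1
    simp [this]

theorem isNonbacktracking_arcLaw (a : G.Dart) : IsNonbacktracking G (arcLaw hdeg a) := by
  intro n x
  rw [arcLaw_cyl, arcLaw_cyl, isNonbacktracking_law hdeg a.fst n x]
  split_ifs
  · rw [mul_assoc]
  · simp

theorem degree_ne_zero (hdeg : ∀ v, 2 ≤ G.degree v) (v : V) : (G.degree v : ℝ≥0∞) ≠ 0 := by
  have := hdeg v
  exact_mod_cast (by omega : G.degree v ≠ 0)

theorem arcLaw_cyl_one (a : G.Dart) (x : ℕ → V) :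
    arcLaw hdeg a (cyl 1 x) = if x 0 = a.fst ∧ x 1 = a.snd then 1 else 0 := by
  rw [arcLaw_cyl, law_cyl_one]
  by_cases h1 : x 1 = a.snd
  · by_cases h0 : x 0 = a.fst
    · have := a.adj
      simp only [h0, h1, this, and_self, if_true]
      exact ENNReal.mul_inv_cancel (degree_ne_zero hdeg _) (ENNReal.natCast_ne_top _)
    · simp [h0]
  · simp [h1]

theorem arcLaw_map_shift_cyl (a : G.Dart) (n : ℕ) (x : ℕ → V) :
    (arcLaw hdeg a).map shift (cyl n x) = arcLaw hdeg a (cyl (n + 1) (cons a.fst x)) := by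
  rw [Measure.map_apply measurable_shift (measurableSet_cyl n x)]
  refine measure_congr ?_
  filter_upwards [arcLaw_ae_zero hdeg a] with ω hω
  refine propext ?_
  change shift ω ∈ cyl n x ↔ ω ∈ cyl (n + 1) (cons a.fst x)
  simp [mem_cyl_cons, hω]

/-- The Markov property of the non-backtracking walk on arcs. -/
theorem arcLaw_map_shift (a : G.Dart) :
    (arcLaw hdeg a).map shift = ∑ b, ENNReal.ofReal (Pnb G a b) • arcLaw hdeg b := by
  have : IsProbabilityMeasure ((arcLaw hdeg a).map shift) :=
    Measure.isProbabilityMeasure_map measurable_shift.aemeasurable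
  -- Both sides obey the same step rule, so only the first two vertices need comparing; at most one
  -- arc `b` contributes to the sum.
  refine IsNonbacktracking.ext (G := G) ?_
    (IsNonbacktracking.sum_smul _ _ fun b => isNonbacktracking_arcLaw hdeg b) fun x => ?_
  · intro n x
    rw [arcLaw_map_shift_cyl, arcLaw_map_shift_cyl, isNonbacktracking_arcLaw hdeg a (n + 1)]
    rfl
  · rw [arcLaw_map_shift_cyl, isNonbacktracking_arcLaw hdeg a 0, arcLaw_cyl_one]
    simp only [Measure.finsetSum_apply, Measure.smul_apply, smul_eq_mul, arcLaw_cyl_one, cons]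
    by_cases hadj : G.Adj (x 0) (x 1)
    · rw [Finset.sum_eq_single ⟨(x 0, x 1), hadj⟩]
      · rw [ofReal_Pnb hdeg]
        by_cases h : x 0 = a.snd
        · simp [h]
        · simp [h, Ne.symm h]
      · intro b _ hb
        rw [if_neg, mul_zero]
        rintro ⟨h0, h1⟩
        exact hb (SimpleGraph.Dart.ext _ _ (Prod.ext h0.symm h1.symm))
      · simp
    · rw [Finset.sum_eq_zero]
      · simp [stepProb, hadj]
      · intro b _
        rw [if_neg, mul_zero]
        rintro ⟨h0, h1⟩
        exact hadj (h0 ▸ h1 ▸ b.adj)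

/-- The law of the walk is obtained by choosing the first step uniformly. -/
theorem law_eq_sum (i : V) :
    law hdeg i = ∑ a : G.Dart, (if a.fst = i then (G.degree i : ℝ≥0∞)⁻¹ else 0) • arcLaw hdeg a := by
  refine IsNonbacktracking.ext (G := G) (isNonbacktracking_law hdeg i)
    (IsNonbacktracking.sum_smul _ _ fun b => isNonbacktracking_arcLaw hdeg b) fun x => ?_
  rw [law_cyl_one]
  simp only [Measure.finsetSum_apply, Measure.smul_apply, smul_eq_mul, arcLaw_cyl_one]
  by_cases hadj : G.Adj (x 0) (x 1)
  · rw [Finset.sum_eq_single ⟨(x 0, x 1), hadj⟩]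
    · simp [hadj]
    · intro b _ hb
      rw [if_neg (c := x 0 = b.fst ∧ x 1 = b.snd), mul_zero]
      rintro ⟨h0, h1⟩
      exact hb (SimpleGraph.Dart.ext _ _ (Prod.ext h0.symm h1.symm))
    · simp
  · rw [Finset.sum_eq_zero]
    · simp [hadj]
    · intro b _
      rw [if_neg (c := x 0 = b.fst ∧ x 1 = b.snd), mul_zero]
      rintro ⟨h0, h1⟩
      exact hadj (h0 ▸ h1 ▸ b.adj)

theorem lintegral_law (i : V) (f : (ℕ → V) → ℝ≥0∞) :
    ∫⁻ ω, f ω ∂(law hdeg i) = ∑ a : G.Dart,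
      (if a.fst = i then (G.degree i : ℝ≥0∞)⁻¹ else 0) * ∫⁻ ω, f ω ∂(arcLaw hdeg a) := by
  rw [law_eq_sum, lintegral_finsetSum_measure]
  simp only [lintegral_smul_measure, smul_eq_mul]

theorem lintegral_shift (a : G.Dart) {f : (ℕ → V) → ℝ≥0∞} (hf : Measurable f) :
    ∫⁻ ω, f (shift ω) ∂(arcLaw hdeg a) =
      ∑ b, ENNReal.ofReal (Pnb G a b) * ∫⁻ ω, f ω ∂(arcLaw hdeg b) := by
  rw [← lintegral_map hf measurable_shift, arcLaw_map_shift, lintegral_finsetSum_measure]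
  simp only [lintegral_smul_measure, smul_eq_mul]

/-! ### First-step equations and finiteness of the expectations. -/

theorem meanHitArc_eq_lintegral (a : G.Dart) (v : V) :
    meanHitArc hdeg a v = ∫⁻ ω, hitTime v ω ∂(arcLaw hdeg a) := rfl

theorem meanHitArc_of_eq {a : G.Dart} {v : V} (h : a.fst = v) : meanHitArc hdeg a v = 0 := by
  rw [meanHitArc_eq_lintegral, lintegral_congr_ae (g := fun _ => 0)]
  · simp
  · filter_upwards [arcLaw_ae_zero hdeg a] with ω hω
    exact hitTime_of_eq (hω.trans h)

theorem lintegral_one_add_shift (a : G.Dart) (v : V) :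
    ∫⁻ ω, (1 + hitTime v (shift ω)) ∂(arcLaw hdeg a) =
      1 + ∑ b, ENNReal.ofReal (Pnb G a b) * meanHitArc hdeg b v := by
  rw [lintegral_add_left measurable_const, lintegral_shift hdeg a (measurable_hitTime v)]
  simp [meanHitArc_eq_lintegral]

/-- An identity in `ℝ≥0∞`, so it needs no prior finiteness. -/
theorem meanHitArc_of_ne {a : G.Dart} {v : V} (h : a.fst ≠ v) :
    meanHitArc hdeg a v = 1 + ∑ b, ENNReal.ofReal (Pnb G a b) * meanHitArc hdeg b v := by
  rw [← lintegral_one_add_shift, meanHitArc_eq_lintegral]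
  refine lintegral_congr_ae ?_
  filter_upwards [arcLaw_ae_zero hdeg a] with ω hω
  exact hitTime_of_ne (hω ▸ h)

theorem meanHit_eq (i v : V) : meanHit hdeg i v = ∑ a : G.Dart,
    (if a.fst = i then (G.degree i : ℝ≥0∞)⁻¹ else 0) * meanHitArc hdeg a v :=
  lintegral_law hdeg i _

theorem meanReturn_eq (i : V) : meanReturn hdeg i = ∑ a : G.Dart,
    (if a.fst = i then (G.degree i : ℝ≥0∞)⁻¹ else 0) *
      (1 + ∑ b, ENNReal.ofReal (Pnb G a b) * meanHitArc hdeg b i) := by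
  rw [meanReturn, lintegral_law]
  simp only [returnTime_eq, lintegral_one_add_shift]

/-- Truncating at `n` allows induction: one step of the walk lowers the truncation level by one,
matching the equation for `h`. Monotone convergence later removes the truncation. -/
theorem lintegral_min_hitTime_le {v : V} {h : G.Dart → ℝ} (h0 : ∀ a, 0 ≤ h a)
    (h1 : ∀ a, a.fst ≠ v → h a = 1 + ∑ b, Pnb G a b * h b) (n : ℕ) (a : G.Dart) :
    ∫⁻ ω, min (hitTime v ω) n ∂(arcLaw hdeg a) ≤ ENNReal.ofReal (h a) := by
  induction n generalizing a with
  | zero => simp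
  | succ n ih =>
    by_cases ha : a.fst = v
    · rw [lintegral_congr_ae (g := fun _ => 0)]
      · simp
      · filter_upwards [arcLaw_ae_zero hdeg a] with ω hω
        rw [hitTime_of_eq (hω.trans ha)]
        simp
    · have hP := fun b => Pnb_nonneg hdeg a b
      calc ∫⁻ ω, min (hitTime v ω) (n + 1 : ℕ) ∂(arcLaw hdeg a)
          = ∫⁻ ω, (1 + min (hitTime v (shift ω)) n) ∂(arcLaw hdeg a) := by
            refine lintegral_congr_ae ?_
            filter_upwards [arcLaw_ae_zero hdeg a] with ω hω
            rw [hitTime_of_ne (hω ▸ ha), ← min_add_add_left, Nat.cast_add, Nat.cast_one,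
              add_comm (n : ℝ≥0∞)]
        _ = 1 + ∑ b, ENNReal.ofReal (Pnb G a b) * ∫⁻ ω, min (hitTime v ω) n ∂(arcLaw hdeg b) := by
            rw [lintegral_add_left measurable_const,
              lintegral_shift hdeg a ((measurable_hitTime v).min measurable_const)]
            simp
        _ ≤ 1 + ∑ b, ENNReal.ofReal (Pnb G a b) * ENNReal.ofReal (h b) := by
            gcongr with b
            exact ih b
        _ = ENNReal.ofReal (h a) := by
            rw [h1 a ha, ENNReal.ofReal_add zero_le_one
              (Finset.sum_nonneg fun b _ => mul_nonneg (hP b) (h0 b)), ENNReal.ofReal_one,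
              ENNReal.ofReal_sum_of_nonneg fun b _ => mul_nonneg (hP b) (h0 b)]
            simp only [ENNReal.ofReal_mul (hP _)]

theorem meanHitArc_ne_top (hconn : G.Connected) (hcycle : ∃ v, 3 ≤ G.degree v) (a : G.Dart)
    (v : V) : meanHitArc hdeg a v ≠ ∞ := by
  obtain ⟨h, h0, h1⟩ := exists_hitting_bound hconn hdeg hcycle v
  refine ne_top_of_le_ne_top (ENNReal.ofReal_ne_top (r := h a)) ?_
  have e : ∀ ω : ℕ → V, hitTime v ω = ⨆ n : ℕ, min (hitTime v ω) n := fun ω => by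
    rw [← inf_iSup_eq, ENNReal.iSup_natCast, inf_top_eq]
  rw [meanHitArc_eq_lintegral, lintegral_congr e, lintegral_iSup]
  · exact iSup_le fun n => lintegral_min_hitTime_le hdeg h0 h1 n a
  · exact fun n => (measurable_hitTime v).min measurable_const
  · intro m n hmn ω
    exact min_le_min_left _ (by exact_mod_cast hmn)

theorem meanHit_ne_top (hconn : G.Connected) (hcycle : ∃ v, 3 ≤ G.degree v) (i v : V) :
    meanHit hdeg i v ≠ ∞ := by
  rw [meanHit_eq]
  refine ENNReal.sum_ne_top.2 fun a _ => ENNReal.mul_ne_top ?_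
    (meanHitArc_ne_top hdeg hconn hcycle a v)
  split_ifs
  · exact ENNReal.inv_ne_top.2 (degree_ne_zero hdeg i)
  · simp

theorem one_add_sum_ne_top (hconn : G.Connected) (hcycle : ∃ v, 3 ≤ G.degree v) (a : G.Dart)
    (v : V) : 1 + ∑ b, ENNReal.ofReal (Pnb G a b) * meanHitArc hdeg b v ≠ ∞ :=
  ENNReal.add_ne_top.2 ⟨ENNReal.one_ne_top, ENNReal.sum_ne_top.2 fun b _ =>
    ENNReal.mul_ne_top ENNReal.ofReal_ne_top (meanHitArc_ne_top hdeg hconn hcycle b v)⟩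

theorem meanReturn_ne_top (hconn : G.Connected) (hcycle : ∃ v, 3 ≤ G.degree v) (i : V) :
    meanReturn hdeg i ≠ ∞ := by
  rw [meanReturn_eq]
  refine ENNReal.sum_ne_top.2 fun a _ => ENNReal.mul_ne_top ?_
    (one_add_sum_ne_top hdeg hconn hcycle a i)
  split_ifs
  · exact ENNReal.inv_ne_top.2 (degree_ne_zero hdeg i)
  · simp

end Law

end

end NBRW

namespace NBRW

noncomputable section

set_option linter.unusedSectionVars false

/-! ### The matrix identities -/

section Matrices

variable {V : Type*} [Fintype V] [DecidableEq V] {G : SimpleGraph V} [DecidableRel G.Adj]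

theorem degree_pos (hdeg : ∀ v, 2 ≤ G.degree v) (v : V) : (0 : ℝ) < G.degree v := by
  linarith [one_le_degree_sub_one hdeg v]

theorem inv_diagonal_mul_apply {ι κ : Type*} [Fintype ι] [DecidableEq ι] {d : ι → ℝ}
    (hd : ∀ i, d i ≠ 0) (A : Matrix ι κ ℝ) (i : ι) (k : κ) :
    ((Matrix.diagonal d)⁻¹ * A) i k = A i k / d i := by
  have h : (Matrix.diagonal d)⁻¹ = Matrix.diagonal fun i => (d i)⁻¹ := by
    refine Matrix.inv_eq_right_inv ?_
    rw [Matrix.diagonal_mul_diagonal, ← Matrix.diagonal_one]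
    congr 1
    funext i
    exact mul_inv_cancel₀ (hd i)
  rw [h, Matrix.diagonal_mul, div_eq_inv_mul]

theorem inv_D_mul_T_mul_apply (hdeg : ∀ v, 2 ≤ G.degree v) {κ : Type*} (A : Matrix G.Dart κ ℝ)
    (i : V) (k : κ) :
    ((D G)⁻¹ * T G * A) i k = (∑ a, if a.fst = i then A a k else 0) / G.degree i := by
  rw [Matrix.mul_assoc, D, inv_diagonal_mul_apply fun v => (degree_pos hdeg v).ne']
  simp only [Matrix.mul_apply, T, Matrix.of_apply, ite_mul, one_mul, zero_mul]

theorem inv_D_mul_T_mul_of_eq (hdeg : ∀ v, 2 ≤ G.degree v) {κ : Type*} {A : Matrix G.Dart κ ℝ}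
    {f : κ → ℝ} (h : ∀ a k, A a k = f k) (i : V) (k : κ) : ((D G)⁻¹ * T G * A) i k = f k := by
  rw [inv_D_mul_T_mul_apply hdeg]
  simp only [h, sum_fst_eq_const]
  exact mul_div_cancel_left₀ _ (degree_pos hdeg i).ne'

theorem We_mul_apply {κ : Type*} (A : Matrix G.Dart κ ℝ) (a : G.Dart) (k : κ) :
    (We G * A) a k = (∑ b, A b k) / (2 * (G.edgeFinset.card : ℝ)) := by
  simp only [Matrix.mul_apply, We, Matrix.of_apply, ← Finset.mul_sum]
  ring

theorem one_sub_Pnb_add_We_mul_of_eq (hdeg : ∀ v, 2 ≤ G.degree v) (hcycle : ∃ v, 3 ≤ G.degree v)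
    {κ : Type*} {A : Matrix G.Dart κ ℝ} {f : κ → ℝ} (h : ∀ a k, A a k = f k) :
    (1 - Pnb G + We G) * A = A := by
  have hm := (two_mul_card_edgeFinset_pos hcycle).ne'
  ext a k
  rw [Matrix.add_mul, Matrix.sub_mul, Matrix.one_mul, Matrix.add_apply, Matrix.sub_apply,
    We_mul_apply, Matrix.mul_apply]
  simp only [h, ← Finset.sum_mul, sum_Pnb_row hdeg, Finset.sum_const, Finset.card_univ,
    nsmul_eq_mul, card_dart_eq, one_mul]
  rw [mul_div_cancel_left₀ _ hm, sub_add_cancel]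

/-- Constant columns are fixed by both `Pnb` and `We`, hence by `1 - Pnb + We` and by its inverse.
-/
theorem Ze_mul_of_eq (hconn : G.Connected) (hdeg : ∀ v, 2 ≤ G.degree v)
    (hcycle : ∃ v, 3 ≤ G.degree v) {κ : Type*} {A : Matrix G.Dart κ ℝ} {f : κ → ℝ}
    (h : ∀ a k, A a k = f k) : Ze G * A = A := by
  have hU := isUnit_one_sub_Pnb_add_We hconn hdeg hcycle
  rw [Matrix.isUnit_iff_isUnit_det] at hU
  nth_rw 1 [← one_sub_Pnb_add_We_mul_of_eq hdeg hcycle h, Ze]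
  exact Matrix.nonsing_inv_mul_cancel_left _ _ hU

theorem Ze_mul_one_sub_Pnb (hconn : G.Connected) (hdeg : ∀ v, 2 ≤ G.degree v)
    (hcycle : ∃ v, 3 ≤ G.degree v) : Ze G * (1 - Pnb G) = 1 - We G := by
  have hU := isUnit_one_sub_Pnb_add_We hconn hdeg hcycle
  rw [Matrix.isUnit_iff_isUnit_det] at hU
  have h := Matrix.nonsing_inv_mul _ hU
  rw [← Ze, Matrix.mul_add, Ze_mul_of_eq hconn hdeg hcycle (A := We G) (fun _ _ => rfl)] at h
  exact eq_sub_of_add_eq h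

variable [MeasurableSpace V] [DiscreteMeasurableSpace V]

theorem toReal_sum_Pnb (hconn : G.Connected) (hdeg : ∀ v, 2 ≤ G.degree v)
    (hcycle : ∃ v, 3 ≤ G.degree v) (a : G.Dart) (v : V) :
    (1 + ∑ b, ENNReal.ofReal (Pnb G a b) * meanHitArc hdeg b v).toReal =
      1 + ∑ b, Pnb G a b * Mev hdeg b v := by
  have hne : ∀ b ∈ Finset.univ, ENNReal.ofReal (Pnb G a b) * meanHitArc hdeg b v ≠ ∞ := fun b _ =>
    ENNReal.mul_ne_top ENNReal.ofReal_ne_top (meanHitArc_ne_top hdeg hconn hcycle b v)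
  rw [ENNReal.toReal_add ENNReal.one_ne_top (ENNReal.sum_ne_top.2 hne), ENNReal.toReal_sum hne]
  simp only [ENNReal.toReal_mul, ENNReal.toReal_ofReal (Pnb_nonneg hdeg a _), ENNReal.toReal_one]
  rfl

theorem toReal_sum_fst (hdeg : ∀ v, 2 ≤ G.degree v) {f : G.Dart → ℝ≥0∞} (hf : ∀ a, f a ≠ ∞)
    (i : V) : (∑ a : G.Dart, (if a.fst = i then (G.degree i : ℝ≥0∞)⁻¹ else 0) * f a).toReal =
      (∑ a, if a.fst = i then (f a).toReal else 0) / G.degree i := by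
  rw [ENNReal.toReal_sum, Finset.sum_div]
  · refine Finset.sum_congr rfl fun a _ => ?_
    split_ifs
    · simp [div_eq_inv_mul]
    · simp
  · intro a _
    refine ENNReal.mul_ne_top ?_ (hf a)
    split_ifs
    · exact ENNReal.inv_ne_top.2 (degree_ne_zero hdeg i)
    · simp

theorem Mev_of_eq (hdeg : ∀ v, 2 ≤ G.degree v) {a : G.Dart} {v : V} (h : a.fst = v) :
    Mev hdeg a v = 0 := by
  rw [Mev, Matrix.of_apply, meanHitArc_of_eq hdeg h, ENNReal.toReal_zero]

/-- The first-step equations in matrix form. On arcs leaving the target the hitting time is 0, and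
`Y` holds the mean return time along that arc as the correction. -/
theorem one_sub_Pnb_mul_Mev (hconn : G.Connected) (hdeg : ∀ v, 2 ≤ G.degree v)
    (hcycle : ∃ v, 3 ≤ G.degree v) :
    (1 - Pnb G) * Mev hdeg = (Matrix.of fun _ _ => (1 : ℝ)) - Y hdeg := by
  ext a v
  rw [Matrix.sub_mul, Matrix.one_mul, Matrix.sub_apply, Matrix.sub_apply, Matrix.mul_apply, Y,
    Matrix.of_apply, Matrix.of_apply]
  by_cases h : a.fst = v
  · rw [Mev_of_eq hdeg h, if_pos h.symm]
    ring
  · rw [if_neg (Ne.symm h)]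
    nth_rw 1 [Mev]
    rw [Matrix.of_apply, meanHitArc_of_ne hdeg h, toReal_sum_Pnb hconn hdeg hcycle]
    ring

theorem Mv_eq (hconn : G.Connected) (hdeg : ∀ v, 2 ≤ G.degree v)
    (hcycle : ∃ v, 3 ≤ G.degree v) : Mv hdeg = (D G)⁻¹ * T G * Mev hdeg := by
  ext i j
  rw [inv_D_mul_T_mul_apply hdeg, Mv, Matrix.of_apply]
  split_ifs with h
  · subst h
    rw [Finset.sum_eq_zero, zero_div]
    intro a _
    split_ifs with ha
    · exact Mev_of_eq hdeg ha
    · rfl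
  · rw [meanHit_eq, toReal_sum_fst hdeg fun a => meanHitArc_ne_top hdeg hconn hcycle a j]
    rfl

theorem R_eq (hconn : G.Connected) (hdeg : ∀ v, 2 ≤ G.degree v)
    (hcycle : ∃ v, 3 ≤ G.degree v) : (D G)⁻¹ * T G * Y hdeg = R hdeg := by
  ext i j
  rw [inv_D_mul_T_mul_apply hdeg]
  by_cases h : i = j
  · subst h
    rw [R, Matrix.diagonal_apply_eq, meanReturn_eq,
      toReal_sum_fst hdeg fun a => one_add_sum_ne_top hdeg hconn hcycle a i]
    congr 1
    refine Finset.sum_congr rfl fun a _ => ?_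
    split_ifs with ha
    · rw [toReal_sum_Pnb hconn hdeg hcycle, Y, Matrix.of_apply, if_pos ha.symm]
    · rfl
  · rw [R, Matrix.diagonal_apply_ne _ h, Finset.sum_eq_zero, zero_div]
    intro a _
    split_ifs with ha
    · rw [Y, Matrix.of_apply, if_neg (fun e => h (ha.symm.trans e.symm))]
    · rfl

theorem Y_of_ne (hdeg : ∀ v, 2 ≤ G.degree v) {a : G.Dart} {v : V} (h : a.fst ≠ v) :
    Y hdeg a v = 0 := by
  rw [Y, Matrix.of_apply, if_neg (Ne.symm h)]

theorem sum_fst_Y (hconn : G.Connected) (hdeg : ∀ v, 2 ≤ G.degree v)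
    (hcycle : ∃ v, 3 ≤ G.degree v) (v : V) :
    (∑ a, if a.fst = v then Y hdeg a v else 0) = G.degree v * R hdeg v v := by
  rw [← R_eq hconn hdeg hcycle, inv_D_mul_T_mul_apply hdeg,
    mul_div_cancel₀ _ (degree_pos hdeg v).ne']

/-- Column sums of `1 - Pnb` vanish, so summing the first-step equations over all arcs leaves the
number of arcs. -/
theorem sum_Y (hconn : G.Connected) (hdeg : ∀ v, 2 ≤ G.degree v)
    (hcycle : ∃ v, 3 ≤ G.degree v) (v : V) :
    ∑ a, Y hdeg a v = 2 * (G.edgeFinset.card : ℝ) := by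
  have h : ∀ a, Mev hdeg a v - ∑ b, Pnb G a b * Mev hdeg b v = 1 - Y hdeg a v := by
    intro a
    have := congrFun (congrFun (one_sub_Pnb_mul_Mev hconn hdeg hcycle) a) v
    rwa [Matrix.sub_mul, Matrix.one_mul, Matrix.sub_apply, Matrix.sub_apply,
      Matrix.mul_apply] at this
  have h1 := Finset.sum_congr rfl fun a (_ : a ∈ Finset.univ) => h a
  rw [Finset.sum_sub_distrib, Finset.sum_sub_distrib, Finset.sum_comm] at h1
  simp only [← Finset.sum_mul, sum_Pnb_col hdeg, one_mul, sub_self, Finset.sum_const,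
    Finset.card_univ, nsmul_eq_mul, card_dart_eq, mul_one] at h1
  linarith

/-- Kac's formula: the mean return time is the inverse of the stationary distribution. -/
theorem π_mul_R (hconn : G.Connected) (hdeg : ∀ v, 2 ≤ G.degree v)
    (hcycle : ∃ v, 3 ≤ G.degree v) (v : V) : π G v * R hdeg v v = 1 := by
  have hm := (two_mul_card_edgeFinset_pos hcycle).ne'
  have h : (∑ a, if a.fst = v then Y hdeg a v else 0) = ∑ a, Y hdeg a v := by
    refine Finset.sum_congr rfl fun a _ => ?_
    split_ifs with ha
    · rfl
    · exact (Y_of_ne hdeg ha).symm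
  rw [sum_Y hconn hdeg hcycle, sum_fst_Y hconn hdeg hcycle] at h
  rw [π, div_mul_eq_mul_div, h, div_self hm]

/-- At an arc ending in `k`, with `d = deg k`, the sum of `Y` over arcs leaving `k` is `d * R`.
Removing the reversed arc gives `(d - 1) * Pnb Y = d * R - τ Y`; combine this with `F = Pnb Y - τ
Y`. At other arcs all terms vanish. -/
theorem inv_De_mul_F_add_S_mul_R (hconn : G.Connected) (hdeg : ∀ v, 2 ≤ G.degree v)
    (hcycle : ∃ v, 3 ≤ G.degree v) :
    (De G)⁻¹ * F hdeg + S G * R hdeg = Pnb G * Y hdeg := by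
  ext a k
  have hd := (degree_pos hdeg a.snd).ne'
  have hd1 : (G.degree a.snd : ℝ) - 1 ≠ 0 := by linarith [one_le_degree_sub_one hdeg a.snd]
  have hτ : (τ G * Y hdeg) a k = Y hdeg a.symm k := by
    simp [Matrix.mul_apply, τ]
  have hP : (Pnb G * Y hdeg) a k =
      ((∑ b, if b.fst = a.snd then Y hdeg b k else 0) - Y hdeg a.symm k)
        / ((G.degree a.snd : ℝ) - 1) := by
    rw [Matrix.mul_apply, sum_Pnb_mul]
  have hS : (S G * R hdeg) a k = if a.snd = k then R hdeg k k else 0 := by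
    rw [R, Matrix.mul_diagonal, S, Matrix.of_apply, Matrix.diagonal_apply_eq]
    split_ifs <;> simp
  rw [Matrix.add_apply, De, inv_diagonal_mul_apply fun a => (degree_pos hdeg _).ne', F,
    Matrix.neg_apply, Matrix.sub_mul, Matrix.sub_apply, hS, hτ, hP]
  by_cases h : a.snd = k
  · subst h
    rw [sum_fst_Y hconn hdeg hcycle, if_pos rfl]
    field_simp
    ring
  · rw [if_neg h, Y_of_ne hdeg (a := a.symm) h, Finset.sum_eq_zero]
    · simp
    · intro b _
      split_ifs with hb
      · exact Y_of_ne hdeg (hb ▸ h)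
      · rfl

theorem Mv_matrix_eq (hconn : G.Connected) (hdeg : ∀ v, 2 ≤ G.degree v)
    (hcycle : ∃ v, 3 ≤ G.degree v) :
    Mv hdeg = (Matrix.of fun _ _ => (1 : ℝ)) - Z G * R hdeg + Wv G * Mv hdeg - E hdeg := by
  have hm := (two_mul_card_edgeFinset_pos hcycle).ne'
  set L := (D G)⁻¹ * T G with hL
  set J : Matrix V V ℝ := Matrix.of fun _ _ => (1 : ℝ)
  set J' : Matrix G.Dart V ℝ := Matrix.of fun _ _ => (1 : ℝ) with hJ'
  have hLJ : L * J' = J := by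
    ext i j
    exact inv_D_mul_T_mul_of_eq hdeg (f := fun _ => 1) (fun _ _ => rfl) i j
  have hLWY : L * (We G * Y hdeg) = J := by
    ext i j
    refine inv_D_mul_T_mul_of_eq hdeg (f := fun _ => 1) (fun a k => ?_) i j
    rw [We_mul_apply, sum_Y hconn hdeg hcycle, div_self hm]
  have hWR : Wv G * R hdeg = J := by
    ext i j
    have := π_mul_R hconn hdeg hcycle j
    rw [R, Matrix.diagonal_apply_eq] at this
    rw [R, Matrix.mul_diagonal, Wv, Matrix.of_apply, this]
    rfl
  -- Weighting averages over outgoing arcs by `deg / 2m` gives the uniform average over all arcs.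
  have hLWM : L * (We G * Mev hdeg) = Wv G * Mv hdeg := by
    ext i j
    rw [inv_D_mul_T_mul_of_eq hdeg (f := fun k => (∑ b, Mev hdeg b k) / _)
      (fun a k => We_mul_apply _ a k), Matrix.mul_apply]
    have : ∀ k, Wv G i k * Mv hdeg k j =
        (∑ a, if a.fst = k then Mev hdeg a j else 0) / (2 * (G.edgeFinset.card : ℝ)) := by
      intro k
      rw [Mv_eq hconn hdeg hcycle, inv_D_mul_T_mul_apply hdeg, Wv, Matrix.of_apply, π]
      have := (degree_pos hdeg k).ne'
      field_simp
    simp only [this, ← Finset.sum_div]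
    rw [Finset.sum_comm]
    simp
  have h1 : Mev hdeg - We G * Mev hdeg = J' - Ze G * Y hdeg := by
    have := congrArg (Ze G * ·) (one_sub_Pnb_mul_Mev hconn hdeg hcycle)
    rw [← Matrix.mul_assoc, Ze_mul_one_sub_Pnb hconn hdeg hcycle, Matrix.mul_sub, Matrix.sub_mul,
      Matrix.one_mul,
      Ze_mul_of_eq hconn hdeg hcycle (f := fun _ => 1) (A := J')
        (fun _ _ => rfl)] at this
    exact this
  have h2 : Mv hdeg - Wv G * Mv hdeg = J - L * (Ze G * Y hdeg) := by
    rw [← hLWM, ← hLJ, ← Matrix.mul_sub, ← h1, Matrix.mul_sub, Mv_eq hconn hdeg hcycle]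
  have h3 : Ze G * Y hdeg - Ze G * (Pnb G * Y hdeg) = Y hdeg - We G * Y hdeg := by
    have := congrArg (· * Y hdeg) (Ze_mul_one_sub_Pnb hconn hdeg hcycle)
    rwa [Matrix.mul_assoc, Matrix.sub_mul, Matrix.sub_mul, Matrix.one_mul, Matrix.mul_sub] at this
  have h4 : Z G * R hdeg + E hdeg = L * (Ze G * Y hdeg) := by
    have e : L * (Ze G * (Pnb G * Y hdeg)) = L * (Ze G * Y hdeg) - (R hdeg - J) := by
      rw [← hLWY, ← R_eq hconn hdeg hcycle, ← hL, ← Matrix.mul_sub, ← h3, Matrix.mul_sub]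
      abel
    rw [Z, E, ← hL, Matrix.sub_mul, Matrix.add_mul, Matrix.one_mul, hWR]
    have e' : L * Ze G * S G * R hdeg + L * Ze G * (De G)⁻¹ * F hdeg =
        L * (Ze G * (Pnb G * Y hdeg)) := by
      rw [← inv_De_mul_F_add_S_mul_R hconn hdeg hcycle]
      simp only [Matrix.mul_add, Matrix.mul_assoc]
      abel
    rw [e] at e'
    rw [eq_sub_iff_add_eq] at e'
    rw [← e']
    abel
  rw [← h4] at h2
  rw [sub_eq_iff_eq_add] at h2
  nth_rw 1 [h2]
  abel

theorem Mv_apply_eq (hconn : G.Connected) (hdeg : ∀ v, 2 ≤ G.degree v)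
    (hcycle : ∃ v, 3 ≤ G.degree v) (i j : V) :
    Mv hdeg i j = (Z G j j - Z G i j) / π G j + E hdeg j j - E hdeg i j := by
  have h : ∀ i, Mv hdeg i j = 1 - Z G i j * R hdeg j j + (∑ k, π G k * Mv hdeg k j)
      - E hdeg i j := by
    intro i
    nth_rw 1 [Mv_matrix_eq hconn hdeg hcycle]
    rw [Matrix.sub_apply, Matrix.add_apply, Matrix.sub_apply, Matrix.mul_apply (M := Wv G), R,
      Matrix.mul_diagonal, Matrix.diagonal_apply_eq]
    rfl
  -- The unknown term `(Wv * Mv) i j` does not depend on `i`, so the zero diagonal entry eliminates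
  -- it.
  have hjj : Mv hdeg j j = 0 := by simp [Mv]
  have hj := h j
  rw [hjj] at hj
  have hR := π_mul_R hconn hdeg hcycle j
  have hR' : R hdeg j j = (π G j)⁻¹ := eq_inv_of_mul_eq_one_right hR
  rw [hR'] at hj
  rw [h i, hR', div_eq_mul_inv]
  linarith

end Matrices

end

end NBRW

theorem mainTheorem3 {V : Type*} [Fintype V] [DecidableEq V]
    [MeasurableSpace V] [DiscreteMeasurableSpace V]
    (G : SimpleGraph V) [DecidableRel G.Adj]
    (hconn : G.Connected) (hdeg : ∀ v, 2 ≤ G.degree v) (hcycle : ∃ v, 3 ≤ G.degree v) :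
    IsUnit (1 - NBRW.Pnb G + NBRW.We G) ∧
    (∀ i v, NBRW.meanHit hdeg i v ≠ ∞) ∧
    (∀ (a : G.Dart) (v : V), NBRW.meanHitArc hdeg a v ≠ ∞) ∧
    (∀ i, NBRW.meanReturn hdeg i ≠ ∞) ∧
    NBRW.Mv hdeg =
      (Matrix.of fun _ _ => (1 : ℝ)) - NBRW.Z G * NBRW.R hdeg + NBRW.Wv G * NBRW.Mv hdeg
        - NBRW.E hdeg ∧
    ∀ i j, NBRW.Mv hdeg i j =
      (NBRW.Z G j j - NBRW.Z G i j) / NBRW.π G j + NBRW.E hdeg j j - NBRW.E hdeg i j := by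
  exact ⟨NBRW.isUnit_one_sub_Pnb_add_We hconn hdeg hcycle,
    NBRW.meanHit_ne_top hdeg hconn hcycle, NBRW.meanHitArc_ne_top hdeg hconn hcycle,
    NBRW.meanReturn_ne_top hdeg hconn hcycle, NBRW.Mv_matrix_eq hconn hdeg hcycle,
    NBRW.Mv_apply_eq hconn hdeg hcycle⟩
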